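/- Let $\mathcal{H}$ be a finite-dimensional complex Hilbert space, let $\rho$ be a positive semi-definite operator on $\mathcal{H}$ with $\mathrm{tr}\,\rho=1$, and let $\sigma$ be any positive semi-definite operator on $\mathcal{H}$. All logarithms are to base $2$, $\log 0=-\infty$, $\log\infty=\infty$, $\inf\emptyset=+\infty$, and divergences take values in $[-\infty,\infty]$. For real $s<1$, the hypothesis-testing divergence is $$D_h^{s}(\rho\|\sigma):=-\log\ \inf\{\mathrm{tr}\,\Lambda\sigma \;:\; 0\le\Lambda\le 1,\ \mathrm{tr}\,\Lambda\rho\ge 1-s\}$$ (so $D_h^s(\rho\|\sigma)=-\infty$ if $s<0$). For positive semi-definite $\tilde\rho$ with $0<\mathrm{tr}\,\tilde\rho\le1$ let $D_{\max}(\tilde\rho\|\sigma):=\inf\{\lambda\in\mathbb{R}:\tilde\rho\le 2^{\lambda}\sigma\}$, let $$P(\rho,\tilde\rho):=\sqrt{1-\bar F(\rho,\tilde\rho)},\qquad \bar F(\rho,\tilde\rho):=\Big(\|\sqrt{\rho}\sqrt{\tilde\rho}\|_1+\sqrt{(1-\mathrm{tr}\,\rho)(1-\mathrm{tr}\,\tilde\rho)}\Big)^2$$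 be the purified distance, and for $r\in[0,1)$ let $$D_{\max}^{r,P}(\rho\|\sigma):=\inf\{D_{\max}(\tilde\rho\|\sigma)\;:\;\tilde\rho\ge0,\ 0<\mathrm{tr}\,\tilde\rho\le1,\ P(\rho,\tilde\rho)\le r\}.$$ Then for every $\varepsilon\in(0,1)$ and $\delta\in(0,1-\varepsilon^2)$, $$D_h^{1-\varepsilon}(\rho\|\sigma)\ \ge\ D_{\max}^{\sqrt{\varepsilon},P}(\rho\|\sigma)-\log\frac{1}{1-\varepsilon}\ \ge\ D_h^{1-\varepsilon-\delta}(\rho\|\sigma)-\log\frac{4}{\delta^2}.$$ -/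

import Mathlib

open scoped ENNReal MatrixOrder ComplexOrder

noncomputable section

namespace OneShot

variable {ι : Type*} [Fintype ι] [DecidableEq ι]

/-- A (normalized) quantum state on `ℂ^ι`: a positive semi-definite matrix of trace one. -/
def IsState (ρ : Matrix ι ι ℂ) : Prop :=
  ρ.PosSemidef ∧ ρ.trace = 1

/-- A sub-normalized state: a positive semi-definite matrix with trace in `(0, 1]`. -/
def IsSubState (ρ : Matrix ι ι ℂ) : Prop :=
  ρ.PosSemidef ∧ 0 < ρ.trace.re ∧ ρ.trace.re ≤ 1

/-- The trace norm `‖X‖₁ = tr |X|` with `|X| = √(Xᴴ X)`. -/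
def traceNorm (X : Matrix ι ι ℂ) : ℝ :=
  (CFC.abs X).trace.re

/-- The fidelity generalized to sub-normalized states,
`(‖√ρ √σ‖₁ + √((1 - tr ρ) (1 - tr σ)))²`. -/
def genFidelity (ρ σ : Matrix ι ι ℂ) : ℝ :=
  (traceNorm (CFC.sqrt ρ * CFC.sqrt σ)
    + Real.sqrt ((1 - ρ.trace.re) * (1 - σ.trace.re))) ^ 2

/-- The purified distance. -/
def purifiedDist (ρ σ : Matrix ι ι ℂ) : ℝ :=
  Real.sqrt (1 - genFidelity ρ σ)

/-- The purified-distance ball of sub-normalized states around `ρ`. -/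
def purifiedBall (ε : ℝ) (ρ : Matrix ι ι ℂ) : Set (Matrix ι ι ℂ) :=
  {τ | IsSubState τ ∧ purifiedDist ρ τ ≤ ε}

/-- The max-divergence `inf {l ∈ ℝ : ρ ≤ 2 ^ l σ}` (Löwner order), with value `⊤` if there is
no such `l`. -/
def Dmax (ρ σ : Matrix ι ι ℂ) : EReal :=
  ⨅ (l : ℝ) (_ : ρ ≤ ((2 : ℝ) ^ l) • σ), (l : EReal)

/-- The max-divergence smoothed over the purified-distance ball. -/
def smoothDmax (ε : ℝ) (ρ σ : Matrix ι ι ℂ) : EReal :=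
  ⨅ τ ∈ purifiedBall ε ρ, Dmax τ σ

/-- The logarithm to base two on `[0, ∞]`, with `log 0 = -∞` and `log ∞ = ∞`. -/
def log2 (x : ℝ≥0∞) : EReal :=
  ENNReal.log x / ((Real.log 2 : ℝ) : EReal)

/-- The minimal error of the second kind `tr Λσ` among the tests `0 ≤ Λ ≤ 1` whose error of the
first kind is at most `ε`, that is, `tr Λρ ≥ 1 - ε` (it is `∞` if there is no such test). -/
def minTypeTwoError (ε : ℝ) (ρ σ : Matrix ι ι ℂ) : ℝ≥0∞ :=
  ⨅ (Λ : Matrix ι ι ℂ) (_ : 0 ≤ Λ ∧ Λ ≤ 1 ∧ 1 - ε ≤ (Λ * ρ).trace.re),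
    ENNReal.ofReal (Λ * σ).trace.re

/-- The hypothesis-testing divergence. -/
def Dh (ε : ℝ) (ρ σ : Matrix ι ι ℂ) : EReal :=
  -log2 (minTypeTwoError ε ρ σ)

end OneShot

end

/-!
The smoothed max-divergence and the hypothesis-testing divergence are compared through tests.

For the upper bound on the smoothed max-divergence, let `β` be the optimal error of the second
kind among the tests that accept `ρ` with probability at least `ε`. The states of fidelity at
least `1 - ε` with `ρ` form a compact set, by continuity of the root fidelity
`tr √(√ρ τ √ρ)` in `τ`, and a convex one, by operator concavity of the square root. If none of them
lies below `β⁻¹ • σ`, the Hahn–Banach theorem yields `M ≥ 0` and `s > 0` with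
`β⁻¹ tr Mσ < s < tr Mτ` for every such `τ`. Cut the spectrum of `M` at `s`, and let `Q` project
onto the upper part. Then `s tr Qσ ≤ tr Mσ < s β`, so the test `Q` is not admissible and
`tr Qρ < ε`. With `P = 1 - Q`, the state `PρP / tr Pρ` has fidelity `tr Pρ > 1 - ε` with `ρ`, and
its pairing with `M` is at most `s`: a contradiction (`exists_mem_fidelityBall_le`). This gives
`smoothDmax_le_Dh` even without the term `log (1 / (1 - ε))`, which is nonnegative.

For the lower bound, let `τ` be in the smoothing ball, `τ ≤ 2 ^ l • σ`, and let `Λ` be a test with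
`tr Λρ ≥ ε + δ`. The fidelity does not decrease under the measurement `{Λ, 1 - Λ}`
(`traceNorm_sqrt_mul_sqrt_le`), so `√(1 - ε) ≤ √(tr Λτ) + √(1 - ε - δ)` and
`tr Λτ ≥ δ² / (4 (1 - ε))` (`sq_div_le_trace_mul`). Since `tr Λτ ≤ 2 ^ l tr Λσ`, every such test
has `tr Λσ` bounded below, which bounds the hypothesis-testing divergence from above.
-/

namespace OneShot

section

-- the operator norm makes the matrices a C⋆-algebra, with their usual topology
open scoped Matrix.Norms.L2Operator

variable {ι : Type*} [Fintype ι] [DecidableEq ι]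

/-! ### Traces of products of positive matrices -/

theorem trace_mul_re_nonneg {A B : Matrix ι ι ℂ} (hA : 0 ≤ A) (hB : 0 ≤ B) :
    0 ≤ (A * B).trace.re := by
  have h : A * B = A * CFC.sqrt B * CFC.sqrt B := by
    rw [mul_assoc, CFC.sqrt_mul_sqrt_self B hB]
  have hs : IsSelfAdjoint (CFC.sqrt B) := (CFC.sqrt_nonneg B).isSelfAdjoint
  rw [h, Matrix.trace_mul_comm, ← mul_assoc]
  have := (Matrix.nonneg_iff_posSemidef.1 (hs.conjugate_nonneg hA)).trace_nonneg
  exact (Complex.le_def.1 this).1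

theorem trace_mul_re_le_left {A B C : Matrix ι ι ℂ} (h : A ≤ B) (hC : 0 ≤ C) :
    (A * C).trace.re ≤ (B * C).trace.re := by
  have := trace_mul_re_nonneg (sub_nonneg.2 h) hC
  rw [sub_mul, Matrix.trace_sub, Complex.sub_re] at this
  linarith

theorem trace_mul_re_le_right {A B C : Matrix ι ι ℂ} (h : A ≤ B) (hC : 0 ≤ C) :
    (C * A).trace.re ≤ (C * B).trace.re := by
  rw [Matrix.trace_mul_comm C A, Matrix.trace_mul_comm C B]
  exact trace_mul_re_le_left h hC

theorem trace_re_mono {A B : Matrix ι ι ℂ} (h : A ≤ B) : A.trace.re ≤ B.trace.re := by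
  simpa using trace_mul_re_le_left h (zero_le_one (α := Matrix ι ι ℂ))

theorem trace_re_nonneg {A : Matrix ι ι ℂ} (h : 0 ≤ A) : 0 ≤ A.trace.re := by
  simpa using trace_re_mono h

/-- The Cauchy–Schwarz inequality for the Hilbert–Schmidt inner product. -/
theorem trace_mul_re_le_sqrt_mul_sqrt (A B : Matrix ι ι ℂ) :
    (A * B).trace.re ≤ √(star A * A).trace.re * √(B * star B).trace.re := by
  have key : ∀ t : ℝ, 0 ≤ (star A * A).trace.re * (t * t) + (-2 * (A * B).trace.re) * t
      + (B * star B).trace.re := by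
    intro t
    have h := trace_re_nonneg (star_mul_self_nonneg (t • A - star B))
    have h1 : (B * A).trace.re = (A * B).trace.re := by rw [Matrix.trace_mul_comm]
    have h2 : (star A * star B).trace.re = (A * B).trace.re := by
      rw [← star_mul, Matrix.star_eq_conjTranspose, Matrix.trace_conjTranspose, ← h1]
      simp
    simp only [star_sub, star_smul, star_star, star_trivial, sub_mul, mul_sub, smul_mul_assoc,
      mul_smul_comm, Matrix.trace_sub, Matrix.trace_smul, Complex.sub_re, Complex.smul_re,
      smul_eq_mul, h1, h2] at h
    linarith
  have hd := discrim_le_zero key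
  rw [discrim] at hd
  rw [← Real.sqrt_mul (trace_re_nonneg (star_mul_self_nonneg A))]
  apply Real.le_sqrt_of_sq_le
  linarith

/-! ### Polar decomposition and the trace norm -/

theorem continuousOn_spectrum (f : ℝ → ℝ) (A : Matrix ι ι ℂ) : ContinuousOn f (spectrum ℝ A) :=
  Matrix.finite_real_spectrum.continuousOn f

/-- The pseudo-inverse `G` of `|X|`: the matrix `G (Xᴴ X) G` is the projection onto the support
of `|X|`, so it is fixed by `X` from the right. -/
theorem exists_pinv_abs (X : Matrix ι ι ℂ) : ∃ G : Matrix ι ι ℂ, 0 ≤ G ∧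
    G * (star X * X) = CFC.abs X ∧ G * (star X * X) * G ≤ 1 ∧
      X * (G * (star X * X) * G) = X := by
  set H := CFC.abs X with hH
  have hH0 : 0 ≤ H := CFC.abs_nonneg X
  have hHs : IsSelfAdjoint H := hH0.isSelfAdjoint
  have hHH : star X * X = H * H := (CFC.abs_mul_abs X).symm
  -- the junk value `0⁻¹ = 0` is what makes this the pseudo-inverse of `H`
  set G := cfc (fun x : ℝ => x⁻¹) H with hG
  have hc (f : ℝ → ℝ) : ContinuousOn f (spectrum ℝ H) := continuousOn_spectrum f H
  have hGH : G * (H * H) = H := by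
    have h : cfc (fun x : ℝ => x⁻¹) H * (cfc (id : ℝ → ℝ) H * cfc (id : ℝ → ℝ) H) = cfc (id : ℝ → ℝ) H := by
      rw [← cfc_mul _ _ _ (hc _) (hc _), ← cfc_mul _ _ _ (hc _) (hc _)]
      refine cfc_congr fun x _ => ?_
      rcases eq_or_ne x 0 with rfl | hx
      · simp
      · simp [hx]
    rwa [cfc_id ℝ H] at h
  have hHG : H * G = cfc (fun x : ℝ => x * x⁻¹) H := by
    nth_rewrite 1 [← cfc_id ℝ H]
    rw [← cfc_mul _ _ _ (hc _) (hc _)]; rfl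
  refine ⟨G, cfc_nonneg fun x hx => inv_nonneg.2 (spectrum_nonneg_of_nonneg hH0 hx),
    by rw [hHH, hGH], ?_, ?_⟩
  · rw [hHH, hGH, hHG]
    exact cfc_le_one _ _ fun x _ => mul_inv_le_one
  · have hz : star (X * (H * G) - X) * (X * (H * G) - X) = 0 := by
      have e1 : X * (H * G) - X = X * (H * G - 1) := by rw [mul_sub, mul_one]
      have e2 : H * (H * G - 1) = 0 := by
        rw [hHG]
        nth_rewrite 1 [← cfc_id ℝ H]
        rw [← cfc_one ℝ H, ← cfc_sub _ _ _ (hc _) (hc _), ← cfc_mul _ _ _ (hc _) (hc _)]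
        rw [← cfc_zero ℝ H]
        refine cfc_congr fun x _ => ?_
        rcases eq_or_ne x 0 with rfl | hx
        · simp
        · simp [hx]
      rw [e1, star_mul, mul_assoc, ← mul_assoc (star X), hHH, mul_assoc H, e2]
      simp
    rw [hHH, hGH]
    exact sub_eq_zero.1 (CStarRing.star_mul_self_eq_zero_iff _ |>.1 hz)

/-- A form of the polar decomposition, with a contraction `W` in place of a unitary. -/
theorem exists_mul_eq_abs (X : Matrix ι ι ℂ) :
    ∃ W : Matrix ι ι ℂ, W * star W ≤ 1 ∧ W * X = CFC.abs X := by
  obtain ⟨G, hG, h1, h2, -⟩ := exists_pinv_abs X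
  refine ⟨G * star X, ?_, by rw [mul_assoc, h1]⟩
  rw [star_mul, star_star, hG.isSelfAdjoint.star_eq]
  simpa only [mul_assoc] using h2

/-- With `G` the pseudo-inverse of `|X|`, one has `|Xᴴ| = X G Xᴴ`, whose trace is `tr |X|`. -/
theorem traceNorm_star (X : Matrix ι ι ℂ) : traceNorm (star X) = traceNorm X := by
  obtain ⟨G, hG, h1, h2, h3⟩ := exists_pinv_abs X
  have h : CFC.abs (star X) = X * G * star X := by
    rw [CFC.abs, star_star]
    refine CFC.sqrt_unique ?_ ?_
    · calc X * G * star X * (X * G * star X) = X * (G * (star X * X) * G) * star X := by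
            simp only [mul_assoc]
        _ = X * star X := by rw [h3]
    · exact star_right_conjugate_nonneg hG X
  rw [traceNorm, traceNorm, h, ← h1, mul_assoc, Matrix.trace_mul_comm, mul_assoc]

/-! ### Fidelity and two-outcome measurements -/

/-- Measuring with the two-outcome test `{Λ, 1 - Λ}` does not decrease the fidelity. With a
contraction `W` such that `W √ρ √τ = |√ρ √τ|`, this is the Cauchy–Schwarz inequality for each of
the two summands of `tr (W √ρ Λ √τ) + tr (W √ρ (1 - Λ) √τ)`. -/
theorem traceNorm_sqrt_mul_sqrt_le {ρ τ Λ : Matrix ι ι ℂ} (hρ : 0 ≤ ρ) (hτ : 0 ≤ τ)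
    (h0 : 0 ≤ Λ) (h1 : Λ ≤ 1) :
    traceNorm (CFC.sqrt ρ * CFC.sqrt τ) ≤
      √(Λ * ρ).trace.re * √(Λ * τ).trace.re +
        √((1 - Λ) * ρ).trace.re * √((1 - Λ) * τ).trace.re := by
  obtain ⟨W, hW, hX⟩ := exists_mul_eq_abs (CFC.sqrt ρ * CFC.sqrt τ)
  have hρs : star (CFC.sqrt ρ) = CFC.sqrt ρ := (CFC.sqrt_nonneg ρ).isSelfAdjoint.star_eq
  have hτs : star (CFC.sqrt τ) = CFC.sqrt τ := (CFC.sqrt_nonneg τ).isSelfAdjoint.star_eq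
  have hρ2 := CFC.sqrt_mul_sqrt_self ρ hρ
  have hτ2 := CFC.sqrt_mul_sqrt_self τ hτ
  have key : ∀ T : Matrix ι ι ℂ, 0 ≤ T → (W * CFC.sqrt ρ * T * CFC.sqrt τ).trace.re ≤
      √(T * ρ).trace.re * √(T * τ).trace.re := by
    intro T hT
    have hTs : star (CFC.sqrt T) = CFC.sqrt T := (CFC.sqrt_nonneg T).isSelfAdjoint.star_eq
    have hT2 := CFC.sqrt_mul_sqrt_self T hT
    have hcs := trace_mul_re_le_sqrt_mul_sqrt (CFC.sqrt T * CFC.sqrt τ * W)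
      (CFC.sqrt ρ * CFC.sqrt T)
    have e1 : (CFC.sqrt T * CFC.sqrt τ * W * (CFC.sqrt ρ * CFC.sqrt T)).trace
        = (W * CFC.sqrt ρ * T * CFC.sqrt τ).trace := by
      rw [mul_assoc (CFC.sqrt T * CFC.sqrt τ), Matrix.trace_mul_comm]
      congr 1
      conv_rhs => rw [← hT2]
      simp only [mul_assoc]
    have e2 : ((CFC.sqrt ρ * CFC.sqrt T) * star (CFC.sqrt ρ * CFC.sqrt T)).trace
        = (T * ρ).trace := by
      rw [star_mul, hρs, hTs, mul_assoc, Matrix.trace_mul_comm]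
      congr 1
      rw [← mul_assoc, hT2, mul_assoc, hρ2]
    have e3 : (star (CFC.sqrt T * CFC.sqrt τ * W) * (CFC.sqrt T * CFC.sqrt τ * W)).trace.re
        ≤ (T * τ).trace.re := by
      rw [Matrix.trace_mul_comm, star_mul]
      have := trace_re_mono (star_right_conjugate_le_conjugate hW (CFC.sqrt T * CFC.sqrt τ))
      have e4 : (CFC.sqrt T * CFC.sqrt τ * 1 * star (CFC.sqrt T * CFC.sqrt τ)).trace
          = (T * τ).trace := by
        rw [mul_one, star_mul, hTs, hτs, mul_assoc, Matrix.trace_mul_comm, ← mul_assoc, hτ2, mul_assoc, hT2,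
          Matrix.trace_mul_comm]
      rw [e4] at this
      simpa only [mul_assoc] using this
    rw [e1, e2] at hcs
    refine hcs.trans ?_
    rw [mul_comm]
    gcongr
  have hsplit : (W * (CFC.sqrt ρ * CFC.sqrt τ)).trace.re =
      (W * CFC.sqrt ρ * Λ * CFC.sqrt τ).trace.re
        + (W * CFC.sqrt ρ * (1 - Λ) * CFC.sqrt τ).trace.re := by
    rw [← Complex.add_re, ← Matrix.trace_add, ← add_mul, ← mul_add, add_sub_cancel, mul_one,
      mul_assoc]
  rw [traceNorm, ← hX, hsplit]
  exact add_le_add (key Λ h0) (key (1 - Λ) (sub_nonneg.2 h1))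

/-- In this form the root fidelity is visibly concave and continuous in `τ`. -/
theorem traceNorm_sqrt_mul_sqrt_eq (ρ : Matrix ι ι ℂ) {τ : Matrix ι ι ℂ} (hτ : 0 ≤ τ) :
    traceNorm (CFC.sqrt ρ * CFC.sqrt τ) =
      (CFC.sqrt (CFC.sqrt ρ * τ * CFC.sqrt ρ)).trace.re := by
  have hρs : star (CFC.sqrt ρ) = CFC.sqrt ρ := (CFC.sqrt_nonneg ρ).isSelfAdjoint.star_eq
  have hτs : star (CFC.sqrt τ) = CFC.sqrt τ := (CFC.sqrt_nonneg τ).isSelfAdjoint.star_eq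
  rw [← traceNorm_star, traceNorm, CFC.abs, star_star, star_mul, hρs, hτs, mul_assoc,
    ← mul_assoc (CFC.sqrt τ), CFC.sqrt_mul_sqrt_self τ hτ, mul_assoc]

/-! ### Spectral cuts and duality -/

/-- Splitting a positive matrix at the level `s` of its spectrum: `Q` is the projection onto the
eigenspaces with eigenvalue above `s`. -/
theorem exists_spectral_cut {M : Matrix ι ι ℂ} (hM : 0 ≤ M) (s : ℝ) :
    ∃ Q : Matrix ι ι ℂ, 0 ≤ Q ∧ Q ≤ 1 ∧ Q * Q = Q ∧ s • Q ≤ M ∧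
      (1 - Q) * M * (1 - Q) ≤ s • (1 - Q) := by
  have hMs : IsSelfAdjoint M := hM.isSelfAdjoint
  have hc (f : ℝ → ℝ) : ContinuousOn f (spectrum ℝ M) := continuousOn_spectrum f M
  have hid : cfc (id : ℝ → ℝ) M = M := cfc_id ℝ M
  set q : ℝ → ℝ := fun x => if s < x then 1 else 0 with hq
  have h1 : 1 - cfc q M = cfc (fun x => 1 - q x) M := by
    rw [cfc_sub _ _ _ (hc _) (hc _), cfc_const_one ℝ M]
  refine ⟨cfc q M, cfc_nonneg fun x _ => ?_, cfc_le_one _ _ fun x _ => ?_, ?_, ?_, ?_⟩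
  · simp only [hq]; split_ifs <;> norm_num
  · simp only [hq]; split_ifs <;> norm_num
  · rw [← cfc_mul _ _ _ (hc _) (hc _)]
    refine cfc_congr fun x _ => ?_
    simp [hq]
  · nth_rewrite 2 [← hid]
    rw [← cfc_smul _ _ _ (hc _)]
    refine cfc_mono (fun x hx => ?_) (hc _) (hc _)
    have := spectrum_nonneg_of_nonneg hM hx
    simp only [hq, smul_eq_mul, id]
    split_ifs with h <;> linarith
  · rw [h1]
    nth_rewrite 2 [← hid]
    rw [← cfc_smul _ _ _ (hc _), ← cfc_mul _ _ _ (hc _) (hc _), ← cfc_mul _ _ _ (hc _) (hc _)]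
    refine cfc_mono (fun x hx => ?_) (hc _) (hc _)
    simp only [hq, smul_eq_mul, id]
    split_ifs with h <;> linarith

theorem exists_trace_mul_eq (f : StrongDual ℂ (Matrix ι ι ℂ)) :
    ∃ N : Matrix ι ι ℂ, ∀ X, f X = (N * X).trace := by
  refine ⟨Matrix.of fun i j => f (Matrix.single j i 1), fun X => ?_⟩
  conv_lhs => rw [Matrix.matrix_eq_sum_single X]
  simp only [map_sum, Matrix.trace, Matrix.diag, Matrix.mul_apply, Matrix.of_apply]
  rw [Finset.sum_comm]
  refine Finset.sum_congr rfl fun i _ => Finset.sum_congr rfl fun j _ => ?_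
  rw [show Matrix.single j i (X j i) = X j i • Matrix.single j i (1 : ℂ) by
    simp [Matrix.smul_single], map_smul, smul_eq_mul, mul_comm]

theorem nonneg_of_trace_mul_nonneg {M : Matrix ι ι ℂ} (hM : IsSelfAdjoint M)
    (h : ∀ A : Matrix ι ι ℂ, 0 ≤ A → 0 ≤ (M * A).trace.re) : 0 ≤ M := by
  have h0 : (M⁻ * M⁻).trace.re ≤ 0 := by
    have h1 := h _ (CFC.negPart_nonneg M)
    have h2 : M * M⁻ = -(M⁻ * M⁻) := by
      nth_rewrite 1 [← CFC.posPart_sub_negPart M hM]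
      rw [sub_mul, CFC.posPart_mul_negPart, zero_sub]
    rw [h2, Matrix.trace_neg, Complex.neg_re] at h1
    linarith
  have hs : star (M⁻) = M⁻ := (CFC.negPart_nonneg M).isSelfAdjoint.star_eq
  have hp : 0 ≤ M⁻ * M⁻ := by
    nth_rewrite 1 [← hs]
    exact star_mul_self_nonneg _
  have ht := (Matrix.nonneg_iff_posSemidef.1 hp).trace_nonneg
  have hz : M⁻ * M⁻ = 0 := by
    rw [← (Matrix.nonneg_iff_posSemidef.1 hp).trace_eq_zero_iff]
    exact le_antisymm (Complex.le_def.2 ⟨h0, (Complex.le_def.1 ht).2.symm⟩) ht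
  have hn : M⁻ = 0 := by
    nth_rewrite 1 [← hs] at hz
    exact CStarRing.star_mul_self_eq_zero_iff _ |>.1 hz
  rw [← CFC.posPart_sub_negPart M hM, hn, sub_zero]
  exact CFC.posPart_nonneg M

/-! ### Balls of states in the fidelity -/

theorem le_one_of_trace_eq_one {τ : Matrix ι ι ℂ} (h0 : 0 ≤ τ) (h1 : τ.trace = 1) : τ ≤ 1 := by
  have hp := Matrix.nonneg_iff_posSemidef.1 h0
  rw [← cfc_id ℝ τ h0.isSelfAdjoint]
  refine cfc_le_one _ _ fun x hx => ?_
  rw [hp.isHermitian.spectrum_real_eq_range_eigenvalues] at hx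
  obtain ⟨i, rfl⟩ := hx
  have hs : ∑ j, hp.isHermitian.eigenvalues j = 1 := by
    have := hp.isHermitian.trace_eq_sum_eigenvalues
    rw [h1] at this
    simpa using (congrArg Complex.re this).symm
  rw [← hs]
  exact Finset.single_le_sum (fun j _ => hp.eigenvalues_nonneg j) (Finset.mem_univ i)

theorem isCompact_normalized : IsCompact {τ : Matrix ι ι ℂ | 0 ≤ τ ∧ τ.trace = 1} := by
  refine (isCompact_closedBall (0 : Matrix ι ι ℂ) 1).of_isClosed_subset ?_ fun τ hτ => ?_
  · exact isClosed_Ici.inter (isClosed_eq (by fun_prop) continuous_const)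
  · rw [mem_closedBall_zero_iff, CStarAlgebra.norm_le_one_iff_of_nonneg τ hτ.1]
    exact le_one_of_trace_eq_one hτ.1 hτ.2

/-- The states (of trace one) whose root fidelity with `ρ` is at least `a`. -/
def fidelityBall (ρ : Matrix ι ι ℂ) (a : ℝ) : Set (Matrix ι ι ℂ) :=
  {τ | (0 ≤ τ ∧ τ.trace = 1) ∧ a ≤ traceNorm (CFC.sqrt ρ * CFC.sqrt τ)}

theorem sqrt_conj_nonneg (ρ : Matrix ι ι ℂ) {τ : Matrix ι ι ℂ} (hτ : 0 ≤ τ) :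
    0 ≤ CFC.sqrt ρ * τ * CFC.sqrt ρ :=
  (CFC.sqrt_nonneg ρ).isSelfAdjoint.conjugate_nonneg hτ

theorem isCompact_fidelityBall (ρ : Matrix ι ι ℂ) (a : ℝ) : IsCompact (fidelityBall ρ a) := by
  have hcont : ContinuousOn (fun τ : Matrix ι ι ℂ => traceNorm (CFC.sqrt ρ * CFC.sqrt τ))
      {τ | 0 ≤ τ ∧ τ.trace = 1} := by
    have h : ContinuousOn (fun τ : Matrix ι ι ℂ =>
        (CFC.sqrt (CFC.sqrt ρ * τ * CFC.sqrt ρ)).trace.re) {τ | 0 ≤ τ ∧ τ.trace = 1} := by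
      have h1 : ContinuousOn (fun τ : Matrix ι ι ℂ => CFC.sqrt (CFC.sqrt ρ * τ * CFC.sqrt ρ))
          {τ | 0 ≤ τ ∧ τ.trace = 1} :=
        CFC.continuousOn_sqrt.comp (by fun_prop) fun τ hτ => sqrt_conj_nonneg ρ hτ.1
      exact Complex.continuous_re.comp_continuousOn
        ((continuous_id.matrix_trace).comp_continuousOn h1)
    exact h.congr fun τ hτ => traceNorm_sqrt_mul_sqrt_eq ρ hτ.1
  refine isCompact_normalized.of_isClosed_subset ?_ fun τ hτ => hτ.1
  exact hcont.preimage_isClosed_of_isClosed isCompact_normalized.isClosed isClosed_Ici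

theorem convex_fidelityBall (ρ : Matrix ι ι ℂ) (a : ℝ) : Convex ℝ (fidelityBall ρ a) := by
  rintro τ ⟨⟨h0, h1⟩, h2⟩ τ' ⟨⟨h0', h1'⟩, h2'⟩ s t hs ht hst
  have hn : 0 ≤ s • τ + t • τ' := add_nonneg (smul_nonneg hs h0) (smul_nonneg ht h0')
  refine ⟨⟨hn, ?_⟩, ?_⟩
  · rw [Matrix.trace_add, Matrix.trace_smul, Matrix.trace_smul, h1, h1', ← add_smul, hst, one_smul]
  · rw [traceNorm_sqrt_mul_sqrt_eq ρ h0] at h2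
    rw [traceNorm_sqrt_mul_sqrt_eq ρ h0'] at h2'
    rw [traceNorm_sqrt_mul_sqrt_eq ρ hn]
    have hc := trace_re_mono (CFC.concaveOn_sqrt.2 (Set.mem_Ici.2 (sqrt_conj_nonneg ρ h0))
      (Set.mem_Ici.2 (sqrt_conj_nonneg ρ h0')) hs ht hst)
    have e : s • (CFC.sqrt ρ * τ * CFC.sqrt ρ) + t • (CFC.sqrt ρ * τ' * CFC.sqrt ρ)
        = CFC.sqrt ρ * (s • τ + t • τ') * CFC.sqrt ρ := by
      simp only [mul_add, add_mul, mul_smul_comm, smul_mul_assoc]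
    rw [e, Matrix.trace_add, Matrix.trace_smul, Matrix.trace_smul, Complex.add_re, Complex.smul_re,
      Complex.smul_re, smul_eq_mul, smul_eq_mul] at hc
    refine le_trans ?_ hc
    calc a = s * a + t * a := by rw [← add_mul, hst, one_mul]
      _ ≤ _ := by gcongr

/-- The state left by the successful outcome of a projective measurement. -/
theorem projection_mem_fidelityBall {ρ P : Matrix ι ι ℂ} (hρ : 0 ≤ ρ)
    (hP : 0 ≤ P) (hPP : P * P = P) (h : 0 < (P * ρ).trace.re) :
    (P * ρ).trace.re⁻¹ • (P * ρ * P) ∈ fidelityBall ρ (√(P * ρ).trace.re) := by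
  set p := (P * ρ).trace.re with hp
  have hPs : IsSelfAdjoint P := hP.isSelfAdjoint
  have hn : 0 ≤ P * ρ * P := hPs.conjugate_nonneg hρ
  have ht : (P * ρ * P).trace = (p : ℂ) := by
    have h1 : (P * ρ * P).trace = (P * ρ).trace := by
      rw [Matrix.trace_mul_comm, ← mul_assoc, hPP]
    have h2 := (Matrix.nonneg_iff_posSemidef.1 hn).trace_nonneg
    rw [h1] at h2 ⊢
    apply Complex.ext
    · simp [hp]
    · simpa using (Complex.le_def.1 h2).2.symm
  have hn' : 0 ≤ p⁻¹ • (P * ρ * P) := smul_nonneg (inv_nonneg.2 h.le) hn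
  refine ⟨⟨hn', ?_⟩, ?_⟩
  · rw [Matrix.trace_smul, ht, Complex.real_smul, ← Complex.ofReal_mul, inv_mul_cancel₀ h.ne',
      Complex.ofReal_one]
  · rw [traceNorm_sqrt_mul_sqrt_eq ρ hn']
    have hs : CFC.sqrt (CFC.sqrt ρ * (p⁻¹ • (P * ρ * P)) * CFC.sqrt ρ)
        = (√p)⁻¹ • (CFC.sqrt ρ * P * CFC.sqrt ρ) := by
      refine CFC.sqrt_unique ?_
        (smul_nonneg (inv_nonneg.2 (Real.sqrt_nonneg p)) (sqrt_conj_nonneg ρ hP))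
      rw [smul_mul_smul_comm, ← mul_inv, Real.mul_self_sqrt h.le, mul_smul_comm, smul_mul_assoc]
      congr 1
      have e : CFC.sqrt ρ * P * CFC.sqrt ρ * (CFC.sqrt ρ * P * CFC.sqrt ρ)
          = CFC.sqrt ρ * (P * (CFC.sqrt ρ * CFC.sqrt ρ) * P) * CFC.sqrt ρ := by
        simp only [mul_assoc]
      rw [e, CFC.sqrt_mul_sqrt_self ρ hρ]
    rw [hs, Matrix.trace_smul, Matrix.trace_mul_comm, ← mul_assoc, CFC.sqrt_mul_sqrt_self ρ hρ,
      Matrix.trace_mul_comm, Complex.smul_re, ← hp, smul_eq_mul, inv_mul_eq_div, Real.div_sqrt]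

/-! ### From tests to dominated states -/

/-- If every test accepting `σ` with probability below `1 / c` accepts `ρ` with probability
below `ε`, then some state of fidelity at least `1 - ε` with `ρ` is dominated by `c • σ`.
Otherwise a positive `M` and a level `s` separate these states from the matrices below `c • σ`,
that is, `c tr Mσ < s < tr Mτ`. The projection `Q` onto the eigenspaces of `M` above `s` accepts
`σ` with probability below `1 / c`, and the state obtained from `ρ` by projecting with `1 - Q`
violates the separation. -/
theorem exists_mem_fidelityBall_le {ρ σ : Matrix ι ι ℂ} (hρ : IsState ρ) (hσ : 0 ≤ σ) {ε c : ℝ}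
    (hε : ε < 1) (hc : 0 ≤ c)
    (h : ∀ Q : Matrix ι ι ℂ, 0 ≤ Q → Q ≤ 1 → c * (Q * σ).trace.re < 1 → (Q * ρ).trace.re < ε) :
    ∃ τ ∈ fidelityBall ρ (√(1 - ε)), τ ≤ c • σ := by
  by_contra! hcon
  have hρ0 : 0 ≤ ρ := Matrix.nonneg_iff_posSemidef.2 hρ.1
  obtain ⟨f, u, v, hu, huv, hv⟩ := RCLike.geometric_hahn_banach_compact_closed (𝕜 := ℂ)
    (convex_fidelityBall ρ (√(1 - ε))) (isCompact_fidelityBall ρ _)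
    (convex_Iic (c • σ)) isClosed_Iic
    (Set.disjoint_left.2 fun τ hτ hle => hcon τ hτ hle)
  obtain ⟨N, hN⟩ := exists_trace_mul_eq f
  -- on self-adjoint matrices the functional `-re f` is given by a self-adjoint `M`; the level `s`
  -- of the separation is `-v`
  set M : Matrix ι ι ℂ := -((1 / 2 : ℝ) • (N + star N)) with hMdef
  have hMs : IsSelfAdjoint M := by
    rw [IsSelfAdjoint, hMdef, star_neg, star_smul, star_add, star_star, star_trivial,
      add_comm N]
  have hM : ∀ X : Matrix ι ι ℂ, IsSelfAdjoint X → (M * X).trace.re = -(f X).re := by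
    intro X hX
    have e : (star N * X).trace.re = (N * X).trace.re := by
      rw [← hX.star_eq, ← star_mul, Matrix.star_eq_conjTranspose, Matrix.trace_conjTranspose,
        hX.star_eq, Matrix.trace_mul_comm]
      simp
    rw [hN, hMdef, neg_mul, Matrix.trace_neg, smul_mul_assoc, add_mul, Matrix.trace_smul,
      Matrix.trace_add, Complex.neg_re, Complex.smul_re, Complex.add_re, e, smul_eq_mul]
    ring
  have hlt : ∀ A : Matrix ι ι ℂ, 0 ≤ A → c * (M * σ).trace.re - (M * A).trace.re < -v := by
    intro A hA
    have h1 := hv (c • σ - A) (Set.mem_Iic.2 (sub_le_self _ hA))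
    have h2 := hM (c • σ - A) ((smul_nonneg hc hσ).isSelfAdjoint.sub hA.isSelfAdjoint)
    rw [mul_sub, Matrix.trace_sub, mul_smul_comm, Matrix.trace_smul, Complex.sub_re,
      Complex.smul_re, smul_eq_mul] at h2
    have h3 : v < (f (c • σ - A)).re := h1
    linarith
  have hM0 : 0 ≤ M := by
    refine nonneg_of_trace_mul_nonneg hMs fun A hA => ?_
    by_contra! hneg
    -- otherwise `A` could be scaled up until the separating inequality fails
    set k : ℝ := max 0 ((-v - c * (M * σ).trace.re) / -(M * A).trace.re)
    have h1 := hlt (k • A) (smul_nonneg (le_max_left _ _) hA)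
    have h2 : (-v - c * (M * σ).trace.re) / -(M * A).trace.re ≤ k := le_max_right _ _
    rw [div_le_iff₀ (by linarith)] at h2
    rw [mul_smul_comm, Matrix.trace_smul, Complex.smul_re, smul_eq_mul] at h1
    linarith
  have hsv : c * (M * σ).trace.re < -v := by simpa using hlt 0 le_rfl
  have hMσ : 0 ≤ (M * σ).trace.re := trace_mul_re_nonneg hM0 hσ
  have hs : 0 < -v := lt_of_le_of_lt (mul_nonneg hc hMσ) hsv
  obtain ⟨Q, hQ0, hQ1, hQQ, hQM, hPM⟩ := exists_spectral_cut hM0 (-v)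
  have hQρ : (Q * ρ).trace.re < ε := by
    refine h Q hQ0 hQ1 ?_
    have h1 := trace_mul_re_le_left hQM hσ
    rw [smul_mul_assoc, Matrix.trace_smul, Complex.smul_re, smul_eq_mul] at h1
    have h2 := mul_le_mul_of_nonneg_left h1 hc
    refine lt_of_mul_lt_mul_left (?_ : -v * (c * (Q * σ).trace.re) < -v * 1) hs.le
    linarith
  -- projecting with `1 - Q` gives a state in the ball whose pairing with `M` is at most `-v`
  have hPP : (1 - Q) * (1 - Q) = 1 - Q := by
    rw [mul_sub, mul_one, sub_mul, one_mul, hQQ, sub_self, sub_zero]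
  have hp : 1 - ε < ((1 - Q) * ρ).trace.re := by
    rw [sub_mul, one_mul, Matrix.trace_sub, hρ.2, Complex.sub_re, Complex.one_re]
    linarith
  have hp0 : 0 < ((1 - Q) * ρ).trace.re := by linarith
  have hmem := projection_mem_fidelityBall hρ0 (sub_nonneg.2 hQ1) hPP hp0
  have h1 := hu _ ⟨hmem.1, (Real.sqrt_le_sqrt hp.le).trans hmem.2⟩
  have h2 := hM _ hmem.1.1.isSelfAdjoint
  have h3 := trace_mul_re_le_left hPM hρ0
  have h4 : (M * ((1 - Q) * ρ * (1 - Q))).trace = ((1 - Q) * M * (1 - Q) * ρ).trace := by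
    rw [Matrix.trace_mul_comm, mul_assoc, Matrix.trace_mul_comm]
    simp only [mul_assoc]
  rw [smul_mul_assoc, Matrix.trace_smul, Complex.smul_re, smul_eq_mul, ← h4] at h3
  rw [mul_smul_comm, Matrix.trace_smul, Complex.smul_re, smul_eq_mul] at h2
  have h5 : ((1 - Q) * ρ).trace.re⁻¹ * (M * ((1 - Q) * ρ * (1 - Q))).trace.re ≤ -v := by
    rw [inv_mul_le_iff₀ hp0]
    linarith
  have h6 : (f (((1 - Q) * ρ).trace.re⁻¹ • ((1 - Q) * ρ * (1 - Q)))).re < u := h1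
  linarith

/-! ### Logarithms and the smoothing ball -/

theorem log2_ofReal_rpow (r : ℝ) : log2 (ENNReal.ofReal ((2 : ℝ) ^ r)) = (r : EReal) := by
  have h2 : Real.log 2 ≠ 0 := (Real.log_pos one_lt_two).ne'
  rw [log2, ENNReal.log_ofReal_of_pos (by positivity), Real.log_rpow two_pos, ← EReal.coe_div,
    mul_div_cancel_right₀ _ h2]

theorem log2_mono : Monotone log2 := fun _ _ h =>
  EReal.monotone_div_right_of_nonneg (EReal.coe_nonneg.2 (Real.log_pos one_lt_two).le)
    (ENNReal.log_monotone h)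

theorem log2_zero : log2 0 = ⊥ := by
  rw [log2, ENNReal.log_zero]
  exact EReal.bot_div_of_pos_ne_top (EReal.coe_pos.2 (Real.log_pos one_lt_two))
    (EReal.coe_ne_top _)

theorem minTypeTwoError_le {ρ σ Λ : Matrix ι ι ℂ} {ε : ℝ} (h0 : 0 ≤ Λ) (h1 : Λ ≤ 1)
    (h : 1 - ε ≤ (Λ * ρ).trace.re) :
    minTypeTwoError ε ρ σ ≤ ENNReal.ofReal (Λ * σ).trace.re :=
  iInf₂_le Λ ⟨h0, h1, h⟩

theorem genFidelity_of_isState {ρ : Matrix ι ι ℂ} (hρ : IsState ρ) (τ : Matrix ι ι ℂ) :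
    genFidelity ρ τ = traceNorm (CFC.sqrt ρ * CFC.sqrt τ) ^ 2 := by
  simp [genFidelity, hρ.2]

theorem traceNorm_nonneg (X : Matrix ι ι ℂ) : 0 ≤ traceNorm X :=
  trace_re_nonneg (CFC.abs_nonneg X)

theorem purifiedDist_le_sqrt_iff {ρ : Matrix ι ι ℂ} (hρ : IsState ρ) (τ : Matrix ι ι ℂ) {ε : ℝ}
    (hε : 0 ≤ ε) :
    purifiedDist ρ τ ≤ √ε ↔ √(1 - ε) ≤ traceNorm (CFC.sqrt ρ * CFC.sqrt τ) := by
  rw [purifiedDist, genFidelity_of_isState hρ, Real.sqrt_le_sqrt_iff hε,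
    Real.sqrt_le_left (traceNorm_nonneg _), sub_le_comm]

theorem fidelityBall_subset_purifiedBall {ρ : Matrix ι ι ℂ} (hρ : IsState ρ) {ε : ℝ}
    (hε : 0 ≤ ε) : fidelityBall ρ (√(1 - ε)) ⊆ purifiedBall (√ε) ρ := by
  rintro τ ⟨⟨h0, h1⟩, h2⟩
  refine ⟨⟨Matrix.nonneg_iff_posSemidef.1 h0, ?_, ?_⟩, (purifiedDist_le_sqrt_iff hρ τ hε).2 h2⟩ <;>
    simp [h1]

/-! ### Comparison of the divergences -/

/-- The smoothed max-divergence is dominated by the hypothesis-testing divergence, with no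
correction term. -/
theorem smoothDmax_le_Dh {ρ σ : Matrix ι ι ℂ} (hρ : IsState ρ) (hσ : 0 ≤ σ) {ε : ℝ}
    (hε : ε ∈ Set.Ioo (0 : ℝ) 1) : smoothDmax (√ε) ρ σ ≤ Dh (1 - ε) ρ σ := by
  rw [Dh]
  -- a vanishing error of the second kind makes the right-hand side `⊤`
  rcases eq_or_ne (minTypeTwoError (1 - ε) ρ σ) 0 with hβ | hβ
  · rw [hβ, log2_zero]
    simp
  have hβt : minTypeTwoError (1 - ε) ρ σ ≠ ⊤ := by
    refine ne_top_of_le_ne_top ENNReal.ofReal_ne_top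
      (minTypeTwoError_le (Λ := 1) zero_le_one le_rfl ?_)
    rw [one_mul, hρ.2, Complex.one_re]
    linarith [hε.2]
  set b := (minTypeTwoError (1 - ε) ρ σ).toReal with hb
  have hb0 : 0 < b := ENNReal.toReal_pos hβ hβt
  have hβb : minTypeTwoError (1 - ε) ρ σ = ENNReal.ofReal b := (ENNReal.ofReal_toReal hβt).symm
  have hbl : (2 : ℝ) ^ Real.logb 2 b = b := Real.rpow_logb two_pos (by norm_num) hb0
  obtain ⟨τ, hτ, hle⟩ := exists_mem_fidelityBall_le hρ hσ hε.2 (inv_nonneg.2 hb0.le)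
    fun Q h0 h1 hQ => by
      by_contra! hQρ
      have h2 := minTypeTwoError_le (σ := σ) (ε := 1 - ε) h0 h1 (by linarith)
      rw [hβb, ENNReal.ofReal_le_ofReal_iff (trace_mul_re_nonneg h0 hσ)] at h2
      rw [inv_mul_lt_iff₀ hb0] at hQ
      linarith
  have hD : Dmax τ σ ≤ ((-Real.logb 2 b : ℝ) : EReal) := by
    refine iInf₂_le (-Real.logb 2 b) ?_
    rwa [Real.rpow_neg two_pos.le, hbl]
  calc smoothDmax (√ε) ρ σ ≤ Dmax τ σ :=
        iInf₂_le τ (fidelityBall_subset_purifiedBall hρ hε.1.le hτ)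
    _ ≤ ((-Real.logb 2 b : ℝ) : EReal) := hD
    _ = _ := by
        rw [hβb, ← hbl, log2_ofReal_rpow, hbl, EReal.coe_neg]

/-- A test that accepts `ρ` with probability at least `ε + δ` accepts every subnormalized state of
fidelity at least `1 - ε` with `ρ` with a probability bounded away from zero. -/
theorem sq_div_le_trace_mul {ρ τ Λ : Matrix ι ι ℂ} (hρ : IsState ρ) (hτ : IsSubState τ) {ε δ : ℝ}
    (hε : ε < 1) (hδ : 0 < δ)
    (hF : √(1 - ε) ≤ traceNorm (CFC.sqrt ρ * CFC.sqrt τ)) (h0 : 0 ≤ Λ) (h1 : Λ ≤ 1)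
    (h : ε + δ ≤ (Λ * ρ).trace.re) : δ ^ 2 / (4 * (1 - ε)) ≤ (Λ * τ).trace.re := by
  have hρ0 := Matrix.nonneg_iff_posSemidef.2 hρ.1
  have hτ0 := Matrix.nonneg_iff_posSemidef.2 hτ.1
  have hp1 : (Λ * ρ).trace.re ≤ 1 := by
    simpa [hρ.2] using trace_mul_re_le_left h1 hρ0
  have hq0 := trace_mul_re_nonneg h0 hτ0
  have hp' : ((1 - Λ) * ρ).trace.re ≤ 1 - ε - δ := by
    rw [sub_mul, one_mul, Matrix.trace_sub, hρ.2, Complex.sub_re, Complex.one_re]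
    linarith
  have hq' : ((1 - Λ) * τ).trace.re ≤ 1 := by
    rw [sub_mul, one_mul, Matrix.trace_sub, Complex.sub_re]
    linarith [hτ.2.2]
  have hp'0 := trace_mul_re_nonneg (sub_nonneg.2 h1) hρ0
  have key : √(1 - ε) ≤ √(Λ * τ).trace.re + √(1 - ε - δ) := by
    refine hF.trans ((traceNorm_sqrt_mul_sqrt_le hρ0 hτ0 h0 h1).trans (add_le_add ?_ ?_))
    · exact mul_le_of_le_one_left (Real.sqrt_nonneg _) (Real.sqrt_le_one.2 hp1)
    · exact (mul_le_of_le_one_right (Real.sqrt_nonneg _) (Real.sqrt_le_one.2 hq')).trans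
        (Real.sqrt_le_sqrt hp')
  set x := √(1 - ε)
  set y := √(1 - ε - δ)
  set z := √(Λ * τ).trace.re
  have hx : x ^ 2 = 1 - ε := Real.sq_sqrt (by linarith)
  have hy : y ^ 2 = 1 - ε - δ := Real.sq_sqrt (by linarith)
  have hz : z ^ 2 = (Λ * τ).trace.re := Real.sq_sqrt hq0
  have hx0 : 0 < x := Real.sqrt_pos.2 (by linarith)
  have hyx : y ≤ x := Real.sqrt_le_sqrt (by linarith)
  have hz0 : 0 ≤ z := Real.sqrt_nonneg _
  have hy0 : 0 ≤ y := Real.sqrt_nonneg _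
  -- `δ = x² - y² = (x - y) (x + y) ≤ z * 2 x`
  have hδ2 : δ ≤ z * (2 * x) := by
    calc δ = (x - y) * (x + y) := by linarith
      _ ≤ z * (2 * x) := by gcongr <;> linarith
  rw [← hz, ← hx, div_le_iff₀ (by positivity)]
  calc δ ^ 2 ≤ (z * (2 * x)) ^ 2 := by gcongr
    _ = z ^ 2 * (4 * x ^ 2) := by ring

/-- The bound of the hypothesis-testing divergence by the max-divergence of a nearby state. -/
theorem Dh_le_of_le_smul {ρ σ τ : Matrix ι ι ℂ} (hρ : IsState ρ) {ε δ l : ℝ}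
    (hε : ε ∈ Set.Ioo (0 : ℝ) 1) (hδ : 0 < δ) (hτ : τ ∈ purifiedBall (√ε) ρ)
    (hl : τ ≤ ((2 : ℝ) ^ l) • σ) :
    Dh (1 - ε - δ) ρ σ ≤
      ((l + (Real.logb 2 (4 / δ ^ 2) - Real.logb 2 (1 / (1 - ε))) : ℝ) : EReal) := by
  have hε1 : 0 < 1 - ε := by linarith [hε.2]
  set r := l + (Real.logb 2 (4 / δ ^ 2) - Real.logb 2 (1 / (1 - ε))) with hr
  have hr2 : (2 : ℝ) ^ (-r) = (2 ^ l)⁻¹ * (δ ^ 2 / (4 * (1 - ε))) := by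
    rw [Real.rpow_neg two_pos.le, hr, Real.rpow_add two_pos, Real.rpow_sub two_pos,
      Real.rpow_logb two_pos (by norm_num) (by positivity),
      Real.rpow_logb two_pos (by norm_num) (by positivity)]
    field_simp
  have hle : ENNReal.ofReal ((2 : ℝ) ^ (-r)) ≤ minTypeTwoError (1 - ε - δ) ρ σ := by
    refine le_iInf₂ fun Λ ⟨h0, h1, h⟩ => ENNReal.ofReal_le_ofReal ?_
    have h2 := sq_div_le_trace_mul hρ hτ.1 hε.2 hδ
      ((purifiedDist_le_sqrt_iff hρ τ hε.1.le).1 hτ.2) h0 h1 (by linarith)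
    have h3 := trace_mul_re_le_right hl h0
    rw [mul_smul_comm, Matrix.trace_smul, Complex.smul_re, smul_eq_mul] at h3
    rw [hr2, inv_mul_le_iff₀ (by positivity)]
    exact h2.trans h3
  have := log2_mono hle
  rw [log2_ofReal_rpow] at this
  rw [Dh, EReal.neg_le, ← EReal.coe_neg]
  exact this

theorem Dh_sub_le_smoothDmax_sub {ρ σ : Matrix ι ι ℂ} (hρ : IsState ρ) {ε δ : ℝ}
    (hε : ε ∈ Set.Ioo (0 : ℝ) 1) (hδ : 0 < δ) :
    Dh (1 - ε - δ) ρ σ - ((Real.logb 2 (4 / δ ^ 2) : ℝ) : EReal) ≤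
      smoothDmax (√ε) ρ σ - ((Real.logb 2 (1 / (1 - ε)) : ℝ) : EReal) := by
  set a := Real.logb 2 (4 / δ ^ 2)
  set b := Real.logb 2 (1 / (1 - ε))
  have h : Dh (1 - ε - δ) ρ σ - ((a - b : ℝ) : EReal) ≤ smoothDmax (√ε) ρ σ := by
    refine le_iInf₂ fun τ hτ => le_iInf₂ fun l hl => ?_
    refine EReal.sub_le_of_le_add ?_
    rw [← EReal.coe_add]
    exact Dh_le_of_le_smul hρ hε hδ hτ hl
  refine le_trans (le_of_eq ?_) (EReal.sub_le_sub h le_rfl)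
  induction Dh (1 - ε - δ) ρ σ with
  | bot => simp
  | top => rw [EReal.top_sub_coe, EReal.top_sub_coe, EReal.top_sub_coe]
  | coe x => norm_cast; ring

end

end OneShot

theorem theorem2 {ι : Type*} [Fintype ι] [DecidableEq ι] (ρ σ : Matrix ι ι ℂ)
    (hρ : OneShot.IsState ρ) (hσ : σ.PosSemidef) (ε δ : ℝ) (hε : ε ∈ Set.Ioo (0 : ℝ) 1)
    (hδ : δ ∈ Set.Ioo (0 : ℝ) (1 - ε ^ 2)) :
    OneShot.Dh (1 - ε) ρ σ
        ≥ OneShot.smoothDmax (Real.sqrt ε) ρ σ - ((Real.logb 2 (1 / (1 - ε)) : ℝ) : EReal) ∧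
      OneShot.smoothDmax (Real.sqrt ε) ρ σ - ((Real.logb 2 (1 / (1 - ε)) : ℝ) : EReal)
        ≥ OneShot.Dh (1 - ε - δ) ρ σ - ((Real.logb 2 (4 / δ ^ 2) : ℝ) : EReal) := by
  have hσ0 : 0 ≤ σ := Matrix.nonneg_iff_posSemidef.2 hσ
  refine ⟨?_, OneShot.Dh_sub_le_smoothDmax_sub hρ hε hδ.1⟩
  have hlog : 0 ≤ Real.logb 2 (1 / (1 - ε)) :=
    Real.logb_nonneg one_lt_two (one_le_one_div (by linarith [hε.2]) (by linarith [hε.1]))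
  have h := EReal.sub_le_sub (OneShot.smoothDmax_le_Dh hρ hσ0 hε) (EReal.coe_nonneg.2 hlog)
  rwa [sub_zero] at h
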